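/- **Setting.** Let $G$ be a finite graph with directed edges $a\to b$ and bidirected edges $a\leftrightarrow b$ ($a\ne b$) and without directed cycles; a pair of nodes may carry both kinds of edge. A linear SEM with graph $G$ is a system $X_v=\sum_{a}\Lambda_{av}X_a+U_v$ with centred, jointly normal errors $U$, where $\Lambda_{ab}=0$ unless $a\to b$ is in $G$, and the error covariance matrix $\Omega$ is positive definite with $\Omega_{ab}=0$ for $a\neq b$ unless $a\leftrightarrow b$ is in $G$. The covariance matrix of $X$ is $\Sigma=(I-\Lambda)^{-T}\,\Omega\,(I-\Lambda)^{-1}$. A path is a sequence of edges, traversed in either direction, that visits no node twice (the trivial path at a node is allowed); it is unblocked if it has no collider. Two nodes are d-separated if no unblocked path joins them. For a path $\pi$ from $a$ to $b$, $\mathrm{Left}(\pi)$ consists of $a$ and the nodes of $\pi$ that a directed edge of $\pi$ leaves towards $a$, and $\mathrm{Right}(\pi)$ of $b$ and the nodes that a directed edge of $\pi$ leaves towards $b$. Paths $\pi_1,\dots,\pi_k$ have no sided intersection if $\mathrm{Left}(\pi_i)\cap\mathrm{Left}(\pi_j)=\mathrm{Right}(\pi_i)\cap\mathrm{Right}(\pi_j)=\emptyset$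 for all $i\ne j$. Let $E_Z$ be a set of directed edges of $G$ whose coefficients are known. The $E_Z$-augmented model adds to the SEM, for every head $v$ of an edge in $E_Z$, a variable $v^*=v-\sum_{(w\to v)\in E_Z}\Lambda_{wv}w$; the augmented graph $G^{E_Z+}$ adds to $G$ the node $v^*$ with the edges $v\to v^*$ and $w\to v^*$ for $(w\to v)\in E_Z$. Let $E=\{x_1\to y,\dots,x_k\to y\}$ be a set of $k$ directed edges of $G$. A set $Z=\{z_1,\dots,z_k\}$ of $k$ nodes is an *auxiliary instrumental set* for $E$ if the set $Z^*$, obtained from $Z$ by replacing each $z_i$ that has an auxiliary variable by $z_i^*$, is an instrumental set for $E$ in $G^{E_Z+}$: it has $k$ elements; in every augmented model, after the coefficients of $E$ are set to $0$, each element of $Z^*$ is independent of $y$; and there are unblocked paths in $G^{E_Z+}$, from the $i$-th element of $Z^*$ to $x_i$ for $i=1,\dots,k$, with no sided intersection. $E$ is *identified* (given the known coefficients) if, for all parameters $(\Lambda,\Omega)$ of $G$ outside a proper algebraic subset of the parameter space, every SEM $(\Lambda',\Omega')$ with graph $G$, with the same $\Sigma$ and with the same coefficients on $E_Z$ satisfies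 $\Lambda'_{x_iy}=\Lambda_{x_iy}$ for all $i$. **Theorem.** Let $E$ and $E_Z$ be as above, let $Z=\{z_1,\dots,z_k\}$ be a set of $k$ nodes, and for each $i$ let $E_{z_i}$ be the set of edges of $E_Z$ with head $z_i$. Suppose that 1. for all $i$, $z_i$ is d-separated from $y$ in the graph $G_{E\cup E_{z_i}}$ obtained from $G$ by deleting the edges in $E\cup E_{z_i}$; and 2. $\pi_1,\dots,\pi_k$ are unblocked paths in $G$ with no sided intersection, $\pi_i$ from $z_i$ to $x_i$. Then $Z$ is an auxiliary instrumental set for $E$. If moreover no $\pi_i$ uses an edge of $E_{z_i}$, so that $\pi_i$ is still a path once the known edges into $z_i$ are deleted, then $E$ is identified. -/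

import Mathlib

/-- A causal graph (path diagram): directed edges `a → b` and bidirected edges `a ↔ b`.
A pair of nodes may be joined both by a directed and by a bidirected edge. -/
structure MixedGraph (V : Type*) where
  dir : V → V → Prop
  bid : V → V → Prop
  bid_symm : ∀ a b, bid a b → bid b a
  bid_irrefl : ∀ a, ¬ bid a a

namespace MixedGraph

variable {V : Type*}

/-- No directed cycles (the model is semi-Markovian). -/
def Acyclic (G : MixedGraph V) : Prop := ∀ v, ¬ Relation.TransGen G.dir v v

/-- The graph obtained by deleting the directed edges in `E`; `(a, b)` stands for `a → b`. -/
def deleteEdges (G : MixedGraph V) (E : Set (V × V)) : MixedGraph V where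
  dir a b := G.dir a b ∧ (a, b) ∉ E
  bid := G.bid
  bid_symm := G.bid_symm
  bid_irrefl := G.bid_irrefl

/-- A sequence of edges from one node to another; each edge is traversed along its direction
(`fwd`), against its direction (`bwd`), or is bidirected (`bi`). -/
inductive Walk (G : MixedGraph V) : V → V → Type _
  | nil (u : V) : Walk G u u
  | fwd {u v w : V} (h : G.dir u v) (p : Walk G v w) : Walk G u w
  | bwd {u v w : V} (h : G.dir v u) (p : Walk G v w) : Walk G u w
  | bi {u v w : V} (h : G.bid u v) (p : Walk G v w) : Walk G u w

namespace Walk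

variable {G : MixedGraph V}

/-- The nodes visited, in order. -/
def support : {u w : V} → G.Walk u w → List V
  | u, _, nil _ => [u]
  | u, _, fwd _ p => u :: p.support
  | u, _, bwd _ p => u :: p.support
  | u, _, bi _ p => u :: p.support

/-- The first edge has an arrowhead at the starting node. -/
def StartsInto : {u w : V} → G.Walk u w → Prop
  | _, _, nil _ => False
  | _, _, fwd _ _ => False
  | _, _, bwd _ _ => True
  | _, _, bi _ _ => True

/-- No inner node is a collider, i.e. has arrowheads from both the preceding and the
following edge. -/
def NoCollider : {u w : V} → G.Walk u w → Prop
  | _, _, nil _ => True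
  | _, _, fwd _ p => ¬ p.StartsInto ∧ p.NoCollider
  | _, _, bwd _ p => p.NoCollider
  | _, _, bi _ p => ¬ p.StartsInto ∧ p.NoCollider

/-- An unblocked path (given the empty set of covariates, which has no ancestors, so that every
collider blocks); a path visits no node twice. -/
def IsUnblockedPath {u w : V} (p : G.Walk u w) : Prop := p.support.Nodup ∧ p.NoCollider

/-- The nodes that a directed edge of the walk leaves in the direction of the starting node. -/
def leavesLeft : {u w : V} → G.Walk u w → Set V
  | _, _, nil _ => ∅
  | _, _, fwd _ p => p.leavesLeft
  | _, _, bwd (v := v) _ p => insert v p.leavesLeft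
  | _, _, bi _ p => p.leavesLeft

/-- The nodes that a directed edge of the walk leaves in the direction of the final node. -/
def leavesRight : {u w : V} → G.Walk u w → Set V
  | _, _, nil _ => ∅
  | u, _, fwd _ p => insert u p.leavesRight
  | _, _, bwd _ p => p.leavesRight
  | _, _, bi _ p => p.leavesRight

/-- `Left(π)`. -/
def left {u w : V} (p : G.Walk u w) : Set V := insert u p.leavesLeft

/-- `Right(π)`. -/
def right {u w : V} (p : G.Walk u w) : Set V := insert w p.leavesRight

/-- The directed edges `(tail, head)` that the walk traverses, in either direction. -/
def dirEdges : {u w : V} → G.Walk u w → Set (V × V)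
  | _, _, nil _ => ∅
  | u, _, fwd (v := v) _ p => insert (u, v) p.dirEdges
  | u, _, bwd (v := v) _ p => insert (v, u) p.dirEdges
  | _, _, bi _ p => p.dirEdges

end Walk

/-- A family of paths has no sided intersection. -/
def NoSidedIntersection {G : MixedGraph V} {k : ℕ} {a b : Fin k → V}
    (π : ∀ i, G.Walk (a i) (b i)) : Prop :=
  ∀ i j, i ≠ j → Disjoint (π i).left (π j).left ∧ Disjoint (π i).right (π j).right

/-- `a` and `b` are d-separated (given no covariates). -/
def DSeparated (G : MixedGraph V) (a b : V) : Prop :=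
  ¬ ∃ p : G.Walk a b, p.IsUnblockedPath

end MixedGraph

/-- The parameters of a linear structural equation model `X v = ∑ a, Λ a v * X a + U v`
with centred errors: `Λ a b` is the coefficient of `a → b`, and `Ω` is the covariance matrix of
the errors `U`. -/
@[ext]
structure LinearSEM (V : Type*) where
  Λ : Matrix V V ℝ
  Ω : Matrix V V ℝ

namespace LinearSEM

variable {V : Type*}

/-- The covariance matrix `(I - Λ)⁻ᵀ Ω (I - Λ)⁻¹` of `X`. -/
noncomputable def covMatrix [Fintype V] [DecidableEq V] (M : LinearSEM V) : Matrix V V ℝ :=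
  ((1 - M.Λ)⁻¹).transpose * M.Ω * (1 - M.Λ)⁻¹

open Classical in
/-- The model in which the edges in `E` are deleted, i.e. their coefficients are set to zero. -/
noncomputable def deleteEdges (M : LinearSEM V) (E : Set (V × V)) : LinearSEM V where
  Λ := Matrix.of fun a b => if (a, b) ∈ E then 0 else M.Λ a b
  Ω := M.Ω

/-- All entries of `Λ` and `Ω` as one vector, at which polynomials can be evaluated. -/
def entries (M : LinearSEM V) : (V × V) ⊕ (V × V) → ℝ :=
  Sum.elim (fun e => M.Λ e.1 e.2) (fun e => M.Ω e.1 e.2)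

end LinearSEM

namespace MixedGraph

variable {V : Type*}

/-- The linear structural equation models with graph `G`. -/
def models (G : MixedGraph V) : Set (LinearSEM V) :=
  {M | (∀ a b, ¬ G.dir a b → M.Λ a b = 0) ∧
    M.Ω.PosDef ∧ (∀ a b, a ≠ b → ¬ G.bid a b → M.Ω a b = 0)}

/-- The coefficients of the edges in `E` are (generically) identified from the covariance matrix
and the known coefficients of the edges in `K`: outside a proper algebraic subset of the
parameter space, they are uniquely determined by these data among all models with graph `G`. -/
def Identified [Fintype V] [DecidableEq V] (G : MixedGraph V) (K E : Set (V × V)) : Prop :=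
  ∃ f : MvPolynomial ((V × V) ⊕ (V × V)) ℝ,
    (∃ M ∈ G.models, MvPolynomial.eval M.entries f ≠ 0) ∧
    ∀ M ∈ G.models, MvPolynomial.eval M.entries f ≠ 0 →
      ∀ N ∈ G.models, N.covMatrix = M.covMatrix →
        (∀ e ∈ K, N.Λ e.1 e.2 = M.Λ e.1 e.2) →
        ∀ e ∈ E, N.Λ e.1 e.2 = M.Λ e.1 e.2

/-- The edges `x i → y`. -/
def edgesTo {k : ℕ} (x : Fin k → V) (y : V) : Set (V × V) := Set.range fun i => (x i, y)

/-- The edges of `K` with head `v`. -/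
def edgesInto (K : Set (V × V)) (v : V) : Set (V × V) := {e ∈ K | e.2 = v}

/-- `z 0, …, z (k - 1)` is a (simple) instrumental set for the edges `x i → y`, in a graph `G` that
carries the class `𝓜` of models.  The variables are jointly normal, so that independence of `z i`
and `y` in the graph with these edges deleted is the vanishing of their covariance in every
model of the class, with the coefficients of these edges deleted. -/
def IsInstrumentalSet [Fintype V] [DecidableEq V] (G : MixedGraph V) (𝓜 : Set (LinearSEM V))
    {k : ℕ} (x : Fin k → V) (y : V) (z : Fin k → V) : Prop :=
  Function.Injective z ∧
  (∀ i, ∀ M ∈ 𝓜, (M.deleteEdges (edgesTo x y)).covMatrix (z i) y = 0) ∧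
  ∃ π : ∀ i, G.Walk (z i) (x i), (∀ i, (π i).IsUnblockedPath) ∧ NoSidedIntersection π

/-- The heads of the edges in `K`. -/
def heads (K : Set (V × V)) : Set V := Prod.snd '' K

/-- The nodes of the augmented graph: the old nodes, and one node `v*` for each head `v` of an
edge in `K`. -/
abbrev AugNode (K : Set (V × V)) : Type _ := V ⊕ heads K

/-- The augmented graph: the new edges are `v → v*`, and `w → v*` for each edge `w → v` in `K`. -/
def augment (G : MixedGraph V) (K : Set (V × V)) : MixedGraph (AugNode K) where
  dir
    | .inl a, .inl b => G.dir a b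
    | .inl a, .inr v => a = v.1 ∨ (a, v.1) ∈ K
    | .inr _, _ => False
  bid
    | .inl a, .inl b => G.bid a b
    | _, _ => False
  bid_symm := by
    rintro (a | a) (b | b) h
    · exact G.bid_symm a b h
    all_goals exact h
  bid_irrefl := by
    rintro (a | a) h
    · exact G.bid_irrefl a h
    · exact h

open Classical in
/-- `v*` if there is an auxiliary variable for `v`, and `v` itself otherwise. -/
noncomputable def star (K : Set (V × V)) (v : V) : AugNode K :=
  if h : v ∈ heads K then .inr ⟨v, h⟩ else .inl v

end MixedGraph

open Classical in
/-- The augmented model: the structural equation of `v*` is `v* = v - ∑ Λ w v * w`, the sum over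
the edges `w → v` in `K`, without an error term. -/
noncomputable def LinearSEM.augment {V : Type*} (M : LinearSEM V) (K : Set (V × V)) :
    LinearSEM (MixedGraph.AugNode K) where
  Λ := Matrix.fromBlocks M.Λ
    (Matrix.of fun a v => (if a = v.1 then 1 else 0) - (if (a, v.1) ∈ K then M.Λ a v.1 else 0)) 0 0
  Ω := Matrix.fromBlocks M.Ω 0 0 0

namespace MixedGraph

open Classical in
/-- `z 0, …, z (k - 1)` is an auxiliary instrumental set for the edges `x i → y`, when the
coefficients of the edges in `K` are known: replacing every node that has an auxiliary variable
by that variable gives an instrumental set in the augmented graph, with the augmented models. -/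
def IsAuxInstrumentalSet {V : Type*} [Fintype V] [DecidableEq V] (G : MixedGraph V)
    (K : Set (V × V)) {k : ℕ} (x : Fin k → V) (y : V) (z : Fin k → V) : Prop :=
  (G.augment K).IsInstrumentalSet ((fun M => M.augment K) '' G.models)
    (fun i => Sum.inl (x i)) (Sum.inl y) (fun i => star K (z i))

end MixedGraph

/-! A linear combination `c` of the variables has the coefficient vector `(1 - Λ)⁻¹ *ᵥ c` in the
errors, and covariances are the `Ω`-pairings of such vectors. Subtracting known terms from a
variable gives it the error expansion that it has after deletion of the corresponding edges: this
applies to `z i` and its known edges, and to `y` and the edges of `E`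
(`inv_mulVec_eq_of_deleteEdges`). By d-separation neither of `z i` and `y` is an ancestor of the
other in the smaller graph, so each deletion leaves the other expansion unchanged. Hence the
auxiliary variable of `z i` is uncorrelated with `y` once `E` is deleted, and with `y - ∑ λ j * x j`
in the original model. Prolonging each path by the edge between `z i` and its auxiliary variable
then gives the instrumental set.

For identification, these vanishing covariances are `k` linear equations for the unknown
coefficients (`starMatrix_covMatrix_mulVec`). The system depends only on the covariance matrix and
the known coefficients, so it suffices that its determinant is generically nonzero. Up to a nonzero
factor it is a polynomial in the parameters, so one good model is enough
(`exists_model_det_ne_zero`).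

To find one, choose `Ω = Wᵀ * W` with one row of `W` for each path; the determinant then splits into
a factor for the `z i` and a factor for the `x i`. Coefficients supported on the left sides of the
paths make the first nonzero, coefficients supported on the right sides the second. Both are nonzero
at some point of the line through these two choices, and a small multiple of the identity makes `Ω`
positive definite. -/

open Matrix Relation

/-! ### Acyclic graphs and the entries of `(1 - Λ)⁻¹` -/

namespace MixedGraph

variable {V : Type*} {G : MixedGraph V}

theorem Acyclic.deleteEdges (hG : G.Acyclic) (E : Set (V × V)) : (G.deleteEdges E).Acyclic :=
  fun v h => hG v (TransGen.mono (fun _ _ h' => h'.1) _ _ h)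

theorem Acyclic.wellFounded [Finite V] (hG : G.Acyclic) : WellFounded (TransGen G.dir) :=
  haveI : Std.Irrefl (TransGen G.dir) := ⟨hG⟩
  Finite.wellFounded_of_trans_of_irrefl _

theorem Acyclic.wellFounded_swap [Finite V] (hG : G.Acyclic) :
    WellFounded (Function.swap (TransGen G.dir)) :=
  haveI : Std.Irrefl (Function.swap (TransGen G.dir)) := ⟨hG⟩
  haveI : IsTrans V (Function.swap (TransGen G.dir)) := ⟨fun _ _ _ h h' => h'.trans h⟩
  Finite.wellFounded_of_trans_of_irrefl _

variable [Fintype V] [DecidableEq V] {Λ : Matrix V V ℝ}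

/-- The value of a kernel vector at a node is a combination of its values at the children, so it
vanishes from the sinks upwards. -/
theorem Acyclic.det_ne_zero (hG : G.Acyclic) (hΛ : ∀ a b, ¬ G.dir a b → Λ a b = 0) :
    (1 - Λ).det ≠ 0 := by
  intro h
  obtain ⟨v, hv, h0⟩ := Matrix.exists_mulVec_eq_zero_iff.2 h
  apply hv
  funext a
  induction a using hG.wellFounded_swap.induction with
  | _ a ih =>
    have h1 := congrFun h0 a
    rw [sub_mulVec, one_mulVec, Pi.sub_apply, Pi.zero_apply, sub_eq_zero] at h1
    rw [h1]
    refine Finset.sum_eq_zero fun b _ => ?_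
    by_cases hab : G.dir a b
    · rw [ih b (TransGen.single hab)]; simp
    · simp [hΛ a b hab]

theorem Acyclic.inv_apply (hG : G.Acyclic) (hΛ : ∀ a b, ¬ G.dir a b → Λ a b = 0) (u a : V) :
    (1 - Λ)⁻¹ u a = (1 : Matrix V V ℝ) u a + ∑ w, (1 - Λ)⁻¹ u w * Λ w a := by
  have h : (1 - Λ)⁻¹ * (1 - Λ) = 1 :=
    nonsing_inv_mul _ (isUnit_iff_ne_zero.2 (hG.det_ne_zero hΛ))
  rw [mul_sub, mul_one, sub_eq_iff_eq_add] at h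
  conv_lhs => rw [h]
  rfl

theorem Acyclic.reflTransGen_of_inv_ne_zero (hG : G.Acyclic)
    (hΛ : ∀ a b, ¬ G.dir a b → Λ a b = 0) {u a : V} (h : (1 - Λ)⁻¹ u a ≠ 0) :
    ReflTransGen G.dir u a := by
  induction a using hG.wellFounded.induction with
  | _ a ih =>
    by_cases hua : u = a
    · rw [hua]
    rw [hG.inv_apply hΛ, one_apply_ne hua, zero_add] at h
    obtain ⟨w, -, hw⟩ := Finset.exists_ne_zero_of_sum_ne_zero h
    have hd : G.dir w a := by
      by_contra hd
      simp [hΛ w a hd] at hw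
    exact (ih w (TransGen.single hd) (left_ne_zero_of_mul hw)).tail hd

theorem Acyclic.inv_apply_self (hG : G.Acyclic) (hΛ : ∀ a b, ¬ G.dir a b → Λ a b = 0) (a : V) :
    (1 - Λ)⁻¹ a a = 1 := by
  rw [hG.inv_apply hΛ, one_apply_eq, add_eq_left]
  refine Finset.sum_eq_zero fun w _ => ?_
  by_contra h
  have hd : G.dir w a := by
    by_contra hd
    simp [hΛ w a hd] at h
  exact hG a (TransGen.tail' (hG.reflTransGen_of_inv_ne_zero hΛ (left_ne_zero_of_mul h)) hd)

end MixedGraph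

/-! ### Error expansions and the deletion of edges -/

namespace LinearSEM

variable {V : Type*}

open Classical in
/-- The coefficients of the edges into `h` that belong to `D`. -/
noncomputable def coefOn (M : LinearSEM V) (D : Set (V × V)) (h : V) : V → ℝ :=
  fun w => if (w, h) ∈ D then M.Λ w h else 0

theorem deleteEdges_mem_models {G : MixedGraph V} {M : LinearSEM V} (hM : M ∈ G.models)
    (D : Set (V × V)) : M.deleteEdges D ∈ (G.deleteEdges D).models := by
  refine ⟨fun a b hab => ?_, hM.2.1, hM.2.2⟩
  by_cases hD : (a, b) ∈ D
  · simp [deleteEdges, hD]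
  · simpa [deleteEdges, hD] using hM.1 a b fun h => hab ⟨h, hD⟩

theorem deleteEdges_union (M : LinearSEM V) (D D' : Set (V × V)) :
    M.deleteEdges (D ∪ D') = (M.deleteEdges D).deleteEdges D' := by
  ext a b
  · by_cases h : (a, b) ∈ D <;> by_cases h' : (a, b) ∈ D' <;> simp [deleteEdges, h, h']
  · rfl

variable [Fintype V] [DecidableEq V]

theorem dotProduct_covMatrix_mulVec (M : LinearSEM V) (c d : V → ℝ) :
    c ⬝ᵥ M.covMatrix *ᵥ d = ((1 - M.Λ)⁻¹ *ᵥ c) ⬝ᵥ M.Ω *ᵥ ((1 - M.Λ)⁻¹ *ᵥ d) := by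
  rw [covMatrix, ← mulVec_mulVec, ← mulVec_mulVec, dotProduct_mulVec, vecMul_transpose]

theorem covMatrix_apply (M : LinearSEM V) (a b : V) :
    M.covMatrix a b = ((1 - M.Λ)⁻¹ *ᵥ Pi.single a 1) ⬝ᵥ M.Ω *ᵥ ((1 - M.Λ)⁻¹ *ᵥ Pi.single b 1) := by
  rw [← dotProduct_covMatrix_mulVec]
  simp

/-- Here `r` is the error expansion of `c` after the deletion of `D`. Only column `h` of `Λ`
changes, and it acts on `r` through the single entry `r h`; correcting `c` by this multiple of the
deleted column restores the same expansion in the full model. -/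
theorem inv_mulVec_eq_of_deleteEdges (M : LinearSEM V) (hdet : (1 - M.Λ).det ≠ 0)
    {D : Set (V × V)} {h : V} (hD : ∀ e ∈ D, e.2 = h) {r c : V → ℝ}
    (hr : (1 - (M.deleteEdges D).Λ) *ᵥ r = c) :
    (1 - M.Λ)⁻¹ *ᵥ (c - r h • M.coefOn D h) = r := by
  have key : (1 - M.Λ) *ᵥ r = c - r h • M.coefOn D h := by
    rw [← hr]
    funext a
    have : (M.Λ *ᵥ r) a = ((M.deleteEdges D).Λ *ᵥ r) a + r h * M.coefOn D h a := by
      have hs : r h * M.coefOn D h a = ∑ b, if b = h then r h * M.coefOn D h a else 0 := by simp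
      rw [hs]
      simp only [mulVec, dotProduct, ← Finset.sum_add_distrib]
      refine Finset.sum_congr rfl fun b _ => ?_
      by_cases hb : b = h
      · subst hb
        by_cases hab : (a, b) ∈ D <;> simp [deleteEdges, coefOn, hab, mul_comm]
      · have hab : (a, b) ∉ D := fun hab => hb (hD _ hab)
        simp [deleteEdges, hab, hb]
    simp only [sub_mulVec, one_mulVec, Pi.sub_apply, Pi.smul_apply, smul_eq_mul, this]
    ring
  rw [← key, mulVec_mulVec, nonsing_inv_mul _ (isUnit_iff_ne_zero.2 hdet), one_mulVec]

end LinearSEM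

/-! ### d-separation and vanishing covariances -/

namespace MixedGraph

variable {V : Type*} {G : MixedGraph V}

theorem Acyclic.exists_directed_path (hG : G.Acyclic) {u b : V} (h : ReflTransGen G.dir u b) :
    ∃ p : G.Walk u b, p.IsUnblockedPath ∧ ¬ p.StartsInto ∧
      ∀ s ∈ p.support, ReflTransGen G.dir u s ∧ ReflTransGen G.dir s b := by
  induction h using ReflTransGen.head_induction_on with
  | refl =>
    refine ⟨.nil b, ⟨by simp [Walk.support], trivial⟩, id, fun s hs => ?_⟩
    simp only [Walk.support, List.mem_singleton] at hs
    exact hs ▸ ⟨.refl, .refl⟩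
  | head hd hr ih =>
    obtain ⟨p, ⟨hn, hc⟩, hs, hp⟩ := ih
    refine ⟨.fwd hd p, ⟨?_, hs, hc⟩, id, fun s hs => ?_⟩
    · exact List.nodup_cons.2 ⟨fun hm => hG _ (TransGen.head' hd (hp _ hm).1), hn⟩
    · rcases List.mem_cons.1 hs with rfl | hs
      · exact ⟨.refl, .head hd hr⟩
      · exact ⟨.head hd (hp s hs).1, (hp s hs).2⟩

/-- The directed path from `u` to `a` is put backwards in front of `p`. A backward edge in front
never creates a collider, and `hdis` keeps the new nodes off `p`. -/
theorem Acyclic.exists_unblocked_of_prepend (hG : G.Acyclic) {u a b : V}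
    (h : ReflTransGen G.dir u a) (p : G.Walk u b) (hp : p.IsUnblockedPath)
    (hdis : ∀ s ∈ p.support, TransGen G.dir u s → ¬ ReflTransGen G.dir s a) :
    ∃ q : G.Walk a b, q.IsUnblockedPath ∧
      ∀ s ∈ q.support, ReflTransGen G.dir s a ∨ s ∈ p.support := by
  induction h with
  | refl => exact ⟨p, hp, fun s hs => .inr hs⟩
  | @tail c a hc hd ih =>
    obtain ⟨q, ⟨hn, hq⟩, hs⟩ := ih fun s h1 h2 h3 => hdis s h1 h2 (h3.tail hd)
    refine ⟨.bwd hd q, ⟨List.nodup_cons.2 ⟨fun hm => ?_, hn⟩, hq⟩, fun s hm => ?_⟩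
    · rcases hs _ hm with h | h
      · exact hG _ (TransGen.tail' h hd)
      · exact hdis _ h (TransGen.tail' hc hd) .refl
    · rcases List.mem_cons.1 hm with rfl | hm
      · exact .inl .refl
      · exact (hs s hm).imp_left fun h => h.tail hd

/-- Below a lowest common ancestor, directed paths to `a` and to `b` cannot meet again, so together
they form an unblocked path. -/
theorem Acyclic.not_dSeparated_of_common_ancestor [Finite V] (hG : G.Acyclic) {u a b : V}
    (ha : ReflTransGen G.dir u a) (hb : ReflTransGen G.dir u b) : ¬ G.DSeparated a b := by
  induction u using hG.wellFounded_swap.induction with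
  | _ u ih =>
    by_cases h : ∃ s, TransGen G.dir u s ∧ ReflTransGen G.dir s a ∧ ReflTransGen G.dir s b
    · obtain ⟨s, hus, hsa, hsb⟩ := h
      exact ih s hus hsa hsb
    · obtain ⟨p, hp, -, hs⟩ := hG.exists_directed_path hb
      obtain ⟨q, hq, -⟩ := hG.exists_unblocked_of_prepend ha p hp
        fun s hm hus hsa => h ⟨s, hus, hsa, (hs s hm).2⟩
      exact fun hsep => hsep ⟨q, hq⟩

theorem Acyclic.not_dSeparated_of_bid [Finite V] (hG : G.Acyclic) {u v a b : V}
    (hbid : G.bid u v) (ha : ReflTransGen G.dir u a) (hb : ReflTransGen G.dir v b) :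
    ¬ G.DSeparated a b := by
  by_cases h : ∃ s, ReflTransGen G.dir s a ∧ ReflTransGen G.dir s b
  · obtain ⟨s, hsa, hsb⟩ := h
    exact hG.not_dSeparated_of_common_ancestor hsa hsb
  · obtain ⟨p, hp, hstart, hs⟩ := hG.exists_directed_path hb
    have hu : u ∉ p.support := fun hm => h ⟨u, ha, (hs u hm).2⟩
    obtain ⟨q, hq, -⟩ := hG.exists_unblocked_of_prepend ha (.bi hbid p)
      ⟨List.nodup_cons.2 ⟨hu, hp.1⟩, hstart, hp.2⟩ (by
        intro s hm hus hsa
        rcases List.mem_cons.1 hm with rfl | hm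
        · exact hG _ hus
        · exact h ⟨s, hsa, (hs s hm).2⟩)
    exact fun hsep => hsep ⟨q, hq⟩

theorem DSeparated.ne {z y : V} (h : G.DSeparated z y) : z ≠ y := by
  rintro rfl
  exact h ⟨.nil z, by simp [Walk.support], trivial⟩

/-- The coefficients of `v*` as a linear combination of the original variables. -/
noncomputable def starVec [DecidableEq V] (M : LinearSEM V) (K : Set (V × V)) (v : V) : V → ℝ :=
  Pi.single v 1 - M.coefOn K v

theorem coefOn_edgesInto {M : LinearSEM V} {E K : Set (V × V)} {y z : V}
    (hE : ∀ e ∈ E, e.2 = y) (hzy : z ≠ y) :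
    (M.deleteEdges E).coefOn (edgesInto K z) z = M.coefOn K z := by
  funext w
  have hw : (w, z) ∉ E := fun h => hzy (hE _ h)
  by_cases hK : (w, z) ∈ K <;> simp [LinearSEM.coefOn, edgesInto, LinearSEM.deleteEdges, hw, hK]

variable [Fintype V] [DecidableEq V]

theorem DSeparated.covMatrix_eq_zero (hG : G.Acyclic) {M : LinearSEM V} (hM : M ∈ G.models)
    {a b : V} (hsep : G.DSeparated a b) : M.covMatrix a b = 0 := by
  by_contra h
  rw [LinearSEM.covMatrix_apply, mulVec_single_one, mulVec_single_one] at h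
  simp only [dotProduct, mulVec, col_apply] at h
  obtain ⟨u, -, hu⟩ := Finset.exists_ne_zero_of_sum_ne_zero h
  obtain ⟨v, -, hv⟩ := Finset.exists_ne_zero_of_sum_ne_zero (right_ne_zero_of_mul hu)
  have hua := hG.reflTransGen_of_inv_ne_zero hM.1 (left_ne_zero_of_mul hu)
  have hvb := hG.reflTransGen_of_inv_ne_zero hM.1 (right_ne_zero_of_mul hv)
  by_cases huv : u = v
  · subst huv
    exact hG.not_dSeparated_of_common_ancestor hua hvb hsep
  · by_cases hbid : G.bid u v
    · exact hG.not_dSeparated_of_bid hbid hua hvb hsep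
    · exact left_ne_zero_of_mul hv (hM.2.2 u v huv hbid)

/-- Every node is its own ancestor, so an ancestor relation between `a` and `b` already provides a
common ancestor. -/
theorem DSeparated.inv_apply_eq_zero (hG : G.Acyclic) {M : LinearSEM V} (hM : M ∈ G.models)
    {a b : V} (hsep : G.DSeparated a b) : (1 - M.Λ)⁻¹ a b = 0 := by
  by_contra h
  exact hG.not_dSeparated_of_common_ancestor .refl (hG.reflTransGen_of_inv_ne_zero hM.1 h) hsep

theorem DSeparated.inv_apply_eq_zero' (hG : G.Acyclic) {M : LinearSEM V} (hM : M ∈ G.models)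
    {a b : V} (hsep : G.DSeparated a b) : (1 - M.Λ)⁻¹ b a = 0 := by
  by_contra h
  exact hG.not_dSeparated_of_common_ancestor (hG.reflTransGen_of_inv_ne_zero hM.1 h) .refl hsep

/-! ### Covariances of the auxiliary variables -/

section

variable {M : LinearSEM V} {E K : Set (V × V)} {y z : V}

/-- The error of `z` has coefficient `1` in `z` itself, so the correction for the deleted edges is
exactly the sum subtracted in the auxiliary variable. -/
theorem inv_deleteEdges_mulVec_starVec (hG : G.Acyclic) (hM : M ∈ G.models)
    (hE : ∀ e ∈ E, e.2 = y) (hzy : z ≠ y) :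
    (1 - (M.deleteEdges E).Λ)⁻¹ *ᵥ starVec M K z =
      (1 - (M.deleteEdges (E ∪ edgesInto K z)).Λ)⁻¹ *ᵥ Pi.single z 1 := by
  have hM2 := LinearSEM.deleteEdges_mem_models hM (E ∪ edgesInto K z)
  have hG2 := hG.deleteEdges (E ∪ edgesInto K z)
  have hM1 := LinearSEM.deleteEdges_mem_models hM E
  have h := LinearSEM.inv_mulVec_eq_of_deleteEdges (M.deleteEdges E)
    ((hG.deleteEdges E).det_ne_zero hM1.1) (D := edgesInto K z) (h := z) (fun e he => he.2)
    (r := (1 - (M.deleteEdges (E ∪ edgesInto K z)).Λ)⁻¹ *ᵥ Pi.single z 1) (c := Pi.single z 1)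
    (by rw [← LinearSEM.deleteEdges_union, mulVec_mulVec,
      mul_nonsing_inv _ (isUnit_iff_ne_zero.2 (hG2.det_ne_zero hM2.1)), one_mulVec])
  rw [← h, coefOn_edgesInto hE hzy, mulVec_single_one, col_apply, hG2.inv_apply_self hM2.1, one_smul,
    starVec]

/-- Deleting the known edges into `z` does not change the expansion of `y`, because the error of `z`
does not enter it. The covariance is therefore that of `z` and `y` in the graph where they are
d-separated. -/
theorem covMatrix_starVec_eq_zero (hG : G.Acyclic) (hM : M ∈ G.models)
    (hE : ∀ e ∈ E, e.2 = y)
    (hsep : (G.deleteEdges (E ∪ edgesInto K z)).DSeparated z y) :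
    starVec M K z ⬝ᵥ (M.deleteEdges E).covMatrix *ᵥ Pi.single y 1 = 0 := by
  have hM2 := LinearSEM.deleteEdges_mem_models hM (E ∪ edgesInto K z)
  have hG2 := hG.deleteEdges (E ∪ edgesInto K z)
  have hM1 := LinearSEM.deleteEdges_mem_models hM E
  rw [LinearSEM.dotProduct_covMatrix_mulVec, inv_deleteEdges_mulVec_starVec hG hM hE hsep.ne]
  have h := LinearSEM.inv_mulVec_eq_of_deleteEdges (M.deleteEdges E)
    ((hG.deleteEdges E).det_ne_zero hM1.1) (D := edgesInto K z) (h := z) (fun e he => he.2)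
    (r := (1 - (M.deleteEdges (E ∪ edgesInto K z)).Λ)⁻¹ *ᵥ Pi.single y 1) (c := Pi.single y 1)
    (by rw [← LinearSEM.deleteEdges_union, mulVec_mulVec,
      mul_nonsing_inv _ (isUnit_iff_ne_zero.2 (hG2.det_ne_zero hM2.1)), one_mulVec])
  rw [mulVec_single_one, col_apply, hsep.inv_apply_eq_zero hG2 hM2, zero_smul, sub_zero,
    ← mulVec_single_one (1 - (M.deleteEdges (E ∪ edgesInto K z)).Λ)⁻¹] at h
  rw [h]
  exact (LinearSEM.covMatrix_apply _ _ _).symm.trans (hsep.covMatrix_eq_zero hG2 hM2)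

theorem starVec_covMatrix_mulVec (hG : G.Acyclic) (hM : M ∈ G.models)
    (hE : ∀ e ∈ E, e.2 = y)
    (hsep : (G.deleteEdges (E ∪ edgesInto K z)).DSeparated z y) :
    starVec M K z ⬝ᵥ M.covMatrix *ᵥ (Pi.single y 1 - M.coefOn E y) = 0 := by
  have hM2 := LinearSEM.deleteEdges_mem_models hM (E ∪ edgesInto K z)
  have hG2 := hG.deleteEdges (E ∪ edgesInto K z)
  have hM1 := LinearSEM.deleteEdges_mem_models hM E
  have hu1 := isUnit_iff_ne_zero.2 ((hG.deleteEdges E).det_ne_zero hM1.1)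
  have hy := LinearSEM.inv_mulVec_eq_of_deleteEdges M (hG.det_ne_zero hM.1) hE
    (r := (1 - (M.deleteEdges E).Λ)⁻¹ *ᵥ Pi.single y 1) (c := Pi.single y 1)
    (by rw [mulVec_mulVec, mul_nonsing_inv _ hu1, one_mulVec])
  have hz := LinearSEM.inv_mulVec_eq_of_deleteEdges M (hG.det_ne_zero hM.1) hE
    (r := (1 - (M.deleteEdges E).Λ)⁻¹ *ᵥ starVec M K z) (c := starVec M K z)
    (by rw [mulVec_mulVec, mul_nonsing_inv _ hu1, one_mulVec])
  -- The error of `y` does not enter the auxiliary variable, so restoring `E` leaves its expansion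
  -- unchanged.
  have hzero : ((1 - (M.deleteEdges E).Λ)⁻¹ *ᵥ starVec M K z) y = 0 := by
    rw [inv_deleteEdges_mulVec_starVec hG hM hE hsep.ne, mulVec_single_one, col_apply,
      hsep.inv_apply_eq_zero' hG2 hM2]
  rw [hzero, zero_smul, sub_zero] at hz
  have hone : ((1 - (M.deleteEdges E).Λ)⁻¹ *ᵥ Pi.single y 1) y = 1 := by
    rw [mulVec_single_one, col_apply, (hG.deleteEdges E).inv_apply_self hM1.1]
  rw [hone, one_smul] at hy
  rw [LinearSEM.dotProduct_covMatrix_mulVec, hz, hy]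
  exact (LinearSEM.dotProduct_covMatrix_mulVec _ _ _).symm.trans
    (covMatrix_starVec_eq_zero hG hM hE hsep)

end

end MixedGraph

/-! ### Paths and covariances in the augmented graph -/

namespace MixedGraph

variable {V : Type*} {G : MixedGraph V} {K : Set (V × V)}

theorem star_injective (K : Set (V × V)) : Function.Injective (star K) := by
  intro a b h
  by_cases ha : a ∈ heads K <;> by_cases hb : b ∈ heads K <;> simp_all [star]

namespace Walk

/-- A walk of `G`, seen in the augmented graph. -/
def toAugment (K : Set (V × V)) : {u w : V} → G.Walk u w → (G.augment K).Walk (.inl u) (.inl w)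
  | _, _, nil u => nil _
  | _, _, fwd (u := u) (v := v) h p =>
    fwd (G := G.augment K) (u := .inl u) (v := .inl v) h (p.toAugment K)
  | _, _, bwd (u := u) (v := v) h p =>
    bwd (G := G.augment K) (u := .inl u) (v := .inl v) h (p.toAugment K)
  | _, _, bi (u := u) (v := v) h p =>
    bi (G := G.augment K) (u := .inl u) (v := .inl v) h (p.toAugment K)

variable {u w : V} (p : G.Walk u w)

theorem support_toAugment : (p.toAugment K).support = p.support.map .inl := by
  induction p <;> simp_all [toAugment, support]

theorem startsInto_toAugment : (p.toAugment K).StartsInto ↔ p.StartsInto := by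
  cases p <;> simp [toAugment, StartsInto]

theorem noCollider_toAugment : (p.toAugment K).NoCollider ↔ p.NoCollider := by
  induction p <;> simp_all [toAugment, NoCollider, startsInto_toAugment]

theorem leavesLeft_toAugment : (p.toAugment K).leavesLeft = .inl '' p.leavesLeft := by
  induction p <;> simp_all [toAugment, leavesLeft, Set.image_insert_eq]

theorem leavesRight_toAugment : (p.toAugment K).leavesRight = .inl '' p.leavesRight := by
  induction p <;> simp_all [toAugment, leavesRight, Set.image_insert_eq]

end Walk

theorem augment_dir_star {v : V} (hv : v ∈ heads K) :
    (G.augment K).dir (.inl v) (.inr ⟨v, hv⟩) := Or.inl rfl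

/-- The new first edge leaves `z` towards the auxiliary node. Since `z` is in `p.left` already, the
left side gains only the auxiliary node and the right side nothing. -/
theorem exists_augment_path {z x : V} (p : G.Walk z x) (hp : p.IsUnblockedPath) :
    ∃ q : (G.augment K).Walk (star K z) (.inl x), q.IsUnblockedPath ∧
      q.left ⊆ insert (star K z) (.inl '' p.left) ∧ q.right = .inl '' p.right := by
  have hp' : (p.toAugment K).IsUnblockedPath :=
    ⟨by rw [Walk.support_toAugment]; exact hp.1.map Sum.inl_injective,
      p.noCollider_toAugment.2 hp.2⟩
  by_cases hz : z ∈ heads K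
  · have hstar : star K z = .inr ⟨z, hz⟩ := by simp [star, hz]
    rw [hstar]
    refine ⟨.bwd (augment_dir_star hz) (p.toAugment K), ⟨?_, hp'.2⟩, ?_, ?_⟩
    · refine List.nodup_cons.2 ⟨?_, hp'.1⟩
      simp [Walk.support_toAugment]
    · simp [Walk.left, Walk.leavesLeft, Walk.leavesLeft_toAugment, Set.image_insert_eq]
    · simp [Walk.right, Walk.leavesRight, Walk.leavesRight_toAugment, Set.image_insert_eq]
  · have hstar : star K z = .inl z := by simp [star, hz]
    rw [hstar]
    refine ⟨p.toAugment K, hp', ?_, ?_⟩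
    · simp [Walk.left, Walk.leavesLeft_toAugment, Set.image_insert_eq]
    · simp [Walk.right, Walk.leavesRight_toAugment, Set.image_insert_eq]

theorem exists_augment_paths {k : ℕ} {x z : Fin k → V} (hz : Function.Injective z)
    (π : ∀ i, G.Walk (z i) (x i)) (hπ : ∀ i, (π i).IsUnblockedPath)
    (hside : NoSidedIntersection π) :
    ∃ q : ∀ i, (G.augment K).Walk (star K (z i)) (.inl (x i)),
      (∀ i, (q i).IsUnblockedPath) ∧ NoSidedIntersection q := by
  choose q hq hl hr using fun i => exists_augment_path (K := K) (π i) (hπ i)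
  have hmem : ∀ i j, i ≠ j → star K (z i) ∉ Sum.inl '' (π j).left := by
    rintro i j hij ⟨a, ha, h⟩
    by_cases hzi : z i ∈ heads K
    · simp [star, hzi] at h
    · simp only [star, hzi, dite_false, Sum.inl.injEq] at h
      exact Set.disjoint_left.1 (hside i j hij).1 (Set.mem_insert _ _) (h ▸ ha)
  refine ⟨q, hq, fun i j hij => ⟨?_, ?_⟩⟩
  · refine Set.disjoint_of_subset (hl i) (hl j) (Set.disjoint_insert_left.2 ⟨?_,
      Set.disjoint_insert_right.2 ⟨hmem j i hij.symm, ?_⟩⟩)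
    · rintro (h | h)
      · exact hij (hz (star_injective K h))
      · exact hmem i j hij h
    · exact (Set.disjoint_image_iff Sum.inl_injective).2 (hside i j hij).1
  · rw [hr, hr]
    exact (Set.disjoint_image_iff Sum.inl_injective).2 (hside i j hij).2

variable [DecidableEq V]

theorem starVec_of_notMem_heads (M : LinearSEM V) {v : V} (hv : v ∉ heads K) :
    starVec M K v = Pi.single v 1 := by
  have : M.coefOn K v = 0 := by
    funext w
    have hw : (w, v) ∉ K := fun h => hv ⟨_, h, rfl⟩
    simp [LinearSEM.coefOn, hw]
  rw [starVec, this, sub_zero]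

variable [Fintype V]

open Classical in
theorem covMatrix_augment_deleteEdges (hG : G.Acyclic) {M : LinearSEM V} (hM : M ∈ G.models)
    {k : ℕ} (x : Fin k → V) (y z : V) :
    ((M.augment K).deleteEdges (edgesTo (fun i => Sum.inl (x i)) (Sum.inl y))).covMatrix
      (star K z) (Sum.inl y) =
      starVec M K z ⬝ᵥ (M.deleteEdges (edgesTo x y)).covMatrix *ᵥ Pi.single y 1 := by
  set N := M.deleteEdges (edgesTo x y) with hN
  set B : Matrix V (heads K) ℝ := Matrix.of fun a v => starVec M K v.1 a with hB
  have hdet : IsUnit (1 - N.Λ).det := isUnit_iff_ne_zero.2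
    ((hG.deleteEdges _).det_ne_zero (LinearSEM.deleteEdges_mem_models hM _).1)
  have hΛ : ((M.augment K).deleteEdges (edgesTo (fun i => Sum.inl (x i)) (Sum.inl y))).Λ =
      fromBlocks N.Λ B 0 0 := by
    ext (a | a) (b | b)
    · simp [LinearSEM.deleteEdges, LinearSEM.augment, hN, edgesTo]
    · simp [LinearSEM.deleteEdges, LinearSEM.augment, hB, edgesTo, starVec, LinearSEM.coefOn,
        Pi.single_apply]
    · simp [LinearSEM.deleteEdges, LinearSEM.augment]
    · simp [LinearSEM.deleteEdges, LinearSEM.augment]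
  -- Auxiliary nodes have no children, so the matrix is block triangular.
  have hinv : (1 - fromBlocks N.Λ B 0 0 : Matrix (V ⊕ heads K) (V ⊕ heads K) ℝ)⁻¹ =
      fromBlocks (1 - N.Λ)⁻¹ ((1 - N.Λ)⁻¹ * B) 0 1 := by
    apply inv_eq_right_inv
    rw [← fromBlocks_one, sub_eq_add_neg, fromBlocks_neg, fromBlocks_add, fromBlocks_multiply]
    simp [← sub_eq_add_neg, mul_nonsing_inv _ hdet, mul_nonsing_inv_cancel_left _ _ hdet]
  have hΩ : ((M.augment K).deleteEdges (edgesTo (fun i => Sum.inl (x i)) (Sum.inl y))).Ω =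
      fromBlocks N.Ω 0 0 0 := rfl
  rw [LinearSEM.covMatrix, hΛ, hΩ, hinv, fromBlocks_transpose, fromBlocks_multiply,
    fromBlocks_multiply]
  by_cases hz : z ∈ heads K
  · simp only [star, hz, dite_true, fromBlocks_apply₂₁, LinearSEM.covMatrix]
    simp only [Matrix.mul_zero, add_zero, transpose_mul, transpose_one, Matrix.mul_assoc]
    simp only [mulVec_single_one]
    rfl
  · simp [star, hz, starVec_of_notMem_heads, LinearSEM.covMatrix]

theorem isAuxInstrumentalSet (hG : G.Acyclic) {k : ℕ} (x : Fin k → V) (y : V)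
    (z : Fin k → V) (hz : Function.Injective z)
    (hsep : ∀ i, (G.deleteEdges (edgesTo x y ∪ edgesInto K (z i))).DSeparated (z i) y)
    (π : ∀ i, G.Walk (z i) (x i)) (hπ : ∀ i, (π i).IsUnblockedPath)
    (hside : NoSidedIntersection π) : G.IsAuxInstrumentalSet K x y z := by
  refine ⟨(star_injective K).comp hz, ?_, exists_augment_paths hz π hπ hside⟩
  rintro i _ ⟨M, hM, rfl⟩
  have h := covMatrix_starVec_eq_zero hG hM (by rintro _ ⟨j, rfl⟩; rfl) (hsep i)
  rw [← h]
  convert covMatrix_augment_deleteEdges hG hM x y (z i)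

end MixedGraph

/-! ### The two sides of a path as matrices and vectors -/

namespace MixedGraph

variable {V : Type*} {G : MixedGraph V}

namespace Walk

theorem start_mem_support {u w : V} (p : G.Walk u w) : u ∈ p.support := by
  cases p <;> simp [support]

theorem left_subset_support {u w : V} (p : G.Walk u w) : ∀ a ∈ p.left, a ∈ p.support := by
  induction p with
  | nil u => simp [left, leavesLeft, support]
  | fwd h p ih | bi h p ih =>
    rintro a (rfl | ha)
    · simp [support]
    · exact List.mem_cons_of_mem _ (ih a (.inr ha))
  | bwd h p ih =>
    rintro a (rfl | ha)
    · simp [support]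
    · exact List.mem_cons_of_mem _ (ih a ha)

theorem right_subset_support {u w : V} (p : G.Walk u w) : ∀ a ∈ p.right, a ∈ p.support := by
  induction p with
  | nil u => simp [right, leavesRight, support]
  | bwd h p ih | bi h p ih => exact fun a ha => List.mem_cons_of_mem _ (ih a ha)
  | fwd h p ih =>
    rintro a (rfl | rfl | ha)
    · exact List.mem_cons_of_mem _ (ih _ (Set.mem_insert _ _))
    · simp [support]
    · exact List.mem_cons_of_mem _ (ih a (.inr ha))

theorem start_mem_right {u w : V} (p : G.Walk u w) (hp : ¬ p.StartsInto) : u ∈ p.right := by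
  cases p <;> simp_all [right, leavesRight, StartsInto]

/-- The last node of the initial segment of edges that are traversed backwards. -/
def leftTop : {u w : V} → G.Walk u w → V
  | u, _, nil _ => u
  | u, _, fwd _ _ => u
  | _, _, bwd _ p => p.leftTop
  | u, _, bi _ _ => u

/-- The first node of the final segment of edges that are traversed forwards, on a walk without
colliders. -/
def rightTop : {u w : V} → G.Walk u w → V
  | u, _, nil _ => u
  | u, _, fwd _ _ => u
  | _, _, bwd _ p => p.rightTop
  | _, _, bi (v := v) _ _ => v

theorem leftTop_mem_left {u w : V} (p : G.Walk u w) : p.leftTop ∈ p.left := by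
  induction p with
  | nil u => exact Set.mem_insert _ _
  | fwd h p ih | bi h p ih => exact Set.mem_insert _ _
  | bwd h p ih => exact Set.mem_insert_of_mem _ ih

theorem rightTop_mem_right {u w : V} (p : G.Walk u w) (hp : p.NoCollider) :
    p.rightTop ∈ p.right := by
  induction p with
  | nil u => exact Set.mem_insert _ _
  | fwd h p ih => exact Set.mem_insert_of_mem _ (Set.mem_insert _ _)
  | bwd h p ih => exact ih hp
  | bi h p ih => exact p.start_mem_right hp.1

theorem tops_eq_or_bid {u w : V} (p : G.Walk u w) :
    p.leftTop = p.rightTop ∨ G.bid p.leftTop p.rightTop := by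
  induction p with
  | nil u => exact .inl rfl
  | fwd h p ih => exact .inl rfl
  | bwd h p ih => exact ih
  | bi h p ih => exact .inr h

variable [DecidableEq V]

/-- The adjacency matrix of the initial segment of edges that are traversed backwards. -/
def leftMatrix : {u w : V} → G.Walk u w → Matrix V V ℝ
  | _, _, nil _ => 0
  | _, _, fwd _ _ => 0
  | u, _, bwd (v := v) _ p => p.leftMatrix + single v u 1
  | _, _, bi _ _ => 0

/-- The adjacency matrix of the edges that are traversed forwards. -/
def rightMatrix : {u w : V} → G.Walk u w → Matrix V V ℝ
  | _, _, nil _ => 0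
  | u, _, fwd (v := v) _ p => p.rightMatrix + single u v 1
  | _, _, bwd _ p => p.rightMatrix
  | _, _, bi _ p => p.rightMatrix

/-- The indicator of the nodes of the initial segment of edges that are traversed backwards. -/
def leftVec : {u w : V} → G.Walk u w → V → ℝ
  | u, _, nil _ => Pi.single u 1
  | u, _, fwd _ _ => Pi.single u 1
  | u, _, bwd _ p => Pi.single u 1 + p.leftVec
  | u, _, bi _ _ => Pi.single u 1

/-- The indicator of the nodes of the final segment of edges that are traversed forwards. -/
def rightVec : {u w : V} → G.Walk u w → V → ℝ
  | u, _, nil _ => Pi.single u 1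
  | u, _, fwd _ p => Pi.single u 1 + p.rightVec
  | _, _, bwd _ p => p.rightVec
  | _, _, bi _ p => p.rightVec

theorem leftVec_eq_zero {u w : V} (p : G.Walk u w) {a : V} (ha : a ∉ p.left) :
    p.leftVec a = 0 := by
  induction p with
  | nil u => simp_all [left, leftVec]
  | fwd h p ih | bi h p ih => simp_all [left, leftVec]
  | bwd h p ih =>
    have h1 : a ∉ p.left := fun h' => ha (Set.mem_insert_of_mem _ h')
    have h2 : a ≠ _ := fun h' => ha (h' ▸ Set.mem_insert _ _)
    simp [leftVec, ih h1, Pi.single_eq_of_ne h2]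

theorem rightVec_eq_zero {u w : V} (p : G.Walk u w) {a : V} (ha : a ∉ p.right) :
    p.rightVec a = 0 := by
  induction p with
  | nil u => simp_all [right, rightVec]
  | bwd h p ih | bi h p ih => exact ih ha
  | fwd h p ih => simp_all [right, rightVec, leavesRight]

theorem leftVec_leftTop {u w : V} (p : G.Walk u w) (hp : p.support.Nodup) :
    p.leftVec p.leftTop = 1 := by
  induction p with
  | nil u => simp [leftVec, leftTop]
  | fwd h p ih | bi h p ih => simp [leftVec, leftTop]
  | @bwd u v w h p ih =>
    have hp' := List.nodup_cons.1 hp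
    have hne : p.leftTop ≠ u :=
      fun h' => hp'.1 (h' ▸ p.left_subset_support _ p.leftTop_mem_left)
    simp [leftVec, leftTop, ih hp'.2, Pi.single_eq_of_ne hne]

theorem rightVec_start {u w : V} (p : G.Walk u w) (hp : p.support.Nodup)
    (hs : ¬ p.StartsInto) : p.rightVec u = 1 := by
  cases p with
  | nil u => simp [rightVec]
  | fwd h p =>
    have hp' := List.nodup_cons.1 hp
    have := p.rightVec_eq_zero fun h' => hp'.1 (p.right_subset_support _ h')
    simp [rightVec, this]
  | bwd h p => exact absurd trivial hs
  | bi h p => exact absurd trivial hs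

theorem rightVec_rightTop {u w : V} (p : G.Walk u w) (hp : p.IsUnblockedPath) :
    p.rightVec p.rightTop = 1 := by
  induction p with
  | nil u => simp [rightVec, rightTop]
  | fwd h p ih => exact (fwd h p).rightVec_start hp.1 id
  | bwd h p ih => exact ih ⟨(List.nodup_cons.1 hp.1).2, hp.2⟩
  | bi h p ih => exact p.rightVec_start (List.nodup_cons.1 hp.1).2 hp.2.1

theorem leftMatrix_apply_ne_zero {u w : V} (p : G.Walk u w) {a b : V}
    (h : p.leftMatrix a b ≠ 0) : (a, b) ∈ p.dirEdges ∧ G.dir a b ∧ b ∈ p.left := by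
  induction p with
  | nil u => simp [leftMatrix] at h
  | fwd _ p ih | bi _ p ih => simp [leftMatrix] at h
  | @bwd u v w hd p ih =>
    by_cases hab : v = a ∧ u = b
    · obtain ⟨rfl, rfl⟩ := hab
      exact ⟨Set.mem_insert _ _, hd, Set.mem_insert _ _⟩
    · rw [leftMatrix, Matrix.add_apply, single_apply, if_neg hab, add_zero] at h
      obtain ⟨h1, h2, h3⟩ := ih h
      exact ⟨Set.mem_insert_of_mem _ h1, h2, Set.mem_insert_of_mem _ h3⟩

theorem rightMatrix_apply_ne_zero {u w : V} (p : G.Walk u w) (hp : p.NoCollider) {a b : V}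
    (h : p.rightMatrix a b ≠ 0) : G.dir a b ∧ b ∈ p.right := by
  induction p with
  | nil u => simp [rightMatrix] at h
  | bwd _ p ih => exact ih hp h
  | bi _ p ih => exact ih hp.2 h
  | @fwd u v w hd p ih =>
    have hsub : p.right ⊆ (fwd hd p).right :=
      Set.insert_subset_insert (Set.subset_insert _ _)
    by_cases hab : u = a ∧ v = b
    · obtain ⟨rfl, rfl⟩ := hab
      exact ⟨hd, hsub (p.start_mem_right hp.1)⟩
    · rw [rightMatrix, Matrix.add_apply, single_apply, if_neg hab, add_zero] at h
      exact (ih hp.2 h).imp_right fun h' => hsub h'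

variable [Fintype V]

/-- The matrix moves the unit vector of each node to the next one towards `leftTop` and kills that
of `leftTop`; the start is the only node not hit. -/
theorem leftMatrix_mulVec {u w : V} (p : G.Walk u w) (hp : p.support.Nodup) :
    p.leftMatrix *ᵥ p.leftVec = p.leftVec - Pi.single u 1 := by
  induction p with
  | nil u => rw [leftMatrix, leftVec, zero_mulVec, sub_self]
  | fwd h p ih | bi h p ih => rw [leftMatrix, leftVec, zero_mulVec, sub_self]
  | @bwd u v w h p ih =>
    have hp' := List.nodup_cons.1 hp
    have hu : u ∉ p.left := fun h' => hp'.1 (p.left_subset_support _ h')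
    have h1 : p.leftMatrix *ᵥ Pi.single u 1 = 0 := by
      rw [mulVec_single_one]
      funext a
      by_contra ha
      exact hu (p.leftMatrix_apply_ne_zero ha).2.2
    have h2 : (single v u (1 : ℝ)) *ᵥ p.leftVec = 0 := by
      simp [single_mulVec, leftVec_eq_zero p hu]
    have h3 : (single v u (1 : ℝ)) *ᵥ Pi.single u 1 = Pi.single v 1 := by
      funext a
      simp [Pi.single_apply, single_apply, eq_comm]
    rw [leftMatrix, leftVec, add_mulVec, mulVec_add, mulVec_add, h1, h2, h3, ih hp'.2]
    abel

/-- Each node of the final directed segment is moved to its predecessor, so only the endpoint is not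
hit. -/
theorem rightMatrix_mulVec {u w : V} (p : G.Walk u w) (hp : p.IsUnblockedPath) :
    p.rightMatrix *ᵥ p.rightVec = p.rightVec - Pi.single w 1 := by
  induction p with
  | nil u => rw [rightMatrix, rightVec, zero_mulVec, sub_self]
  | bwd h p ih => exact ih ⟨(List.nodup_cons.1 hp.1).2, hp.2⟩
  | bi h p ih => exact ih ⟨(List.nodup_cons.1 hp.1).2, hp.2.2⟩
  | @fwd u v w h p ih =>
    have hp' := List.nodup_cons.1 hp.1
    have hu : u ∉ p.right := fun h' => hp'.1 (p.right_subset_support _ h')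
    have huv : u ≠ v := fun h' => hp'.1 (h' ▸ p.start_mem_support)
    have h1 : p.rightMatrix *ᵥ Pi.single u 1 = 0 := by
      rw [mulVec_single_one]
      funext a
      by_contra ha
      exact hu (p.rightMatrix_apply_ne_zero hp.2.2 ha).2
    rw [rightMatrix, rightVec, add_mulVec, mulVec_add, mulVec_add, h1, ih ⟨hp'.2, hp.2.2⟩]
    funext a
    simp [single_mulVec, rightVec_start p hp'.2 hp.2.1, huv.symm, Pi.single_apply,
      Function.update_apply]
    ring

end Walk

/-! ### Families of paths without sided intersection -/

section

variable [DecidableEq V] {k : ℕ} {x z : Fin k → V}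

theorem leftVec_leftTop_eq {π : ∀ i, G.Walk (z i) (x i)} (hπ : ∀ i, (π i).IsUnblockedPath)
    (hside : NoSidedIntersection π) (i j : Fin k) :
    (π j).leftVec (π i).leftTop = if i = j then 1 else 0 := by
  split_ifs with h
  · exact h ▸ (π i).leftVec_leftTop (hπ i).1
  · exact (π j).leftVec_eq_zero (Set.disjoint_left.1 (hside i j h).1 (π i).leftTop_mem_left)

theorem rightVec_rightTop_eq {π : ∀ i, G.Walk (z i) (x i)} (hπ : ∀ i, (π i).IsUnblockedPath)
    (hside : NoSidedIntersection π) (i j : Fin k) :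
    (π j).rightVec (π i).rightTop = if i = j then 1 else 0 := by
  split_ifs with h
  · exact h ▸ (π i).rightVec_rightTop (hπ i)
  · exact (π j).rightVec_eq_zero
      (Set.disjoint_left.1 (hside i j h).2 ((π i).rightTop_mem_right (hπ i).2))

variable (π : ∀ i, G.Walk (z i) (x i))

/-- The sum of the matrices `(π i).leftMatrix`. -/
def leftSum : Matrix V V ℝ := ∑ i, (π i).leftMatrix

/-- The sum of the matrices `(π i).rightMatrix`. -/
def rightSum : Matrix V V ℝ := ∑ i, (π i).rightMatrix

theorem leftSum_apply_ne_zero {a b : V} (h : leftSum π a b ≠ 0) :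
    ∃ i, (π i).leftMatrix a b ≠ 0 := by
  rw [leftSum, Matrix.sum_apply] at h
  exact (Finset.exists_ne_zero_of_sum_ne_zero h).imp fun _ h => h.2

theorem rightSum_apply_ne_zero {a b : V} (h : rightSum π a b ≠ 0) :
    ∃ i, (π i).rightMatrix a b ≠ 0 := by
  rw [rightSum, Matrix.sum_apply] at h
  exact (Finset.exists_ne_zero_of_sum_ne_zero h).imp fun _ h => h.2

theorem leftSum_supported {a b : V} (h : ¬ G.dir a b) : leftSum π a b = 0 := by
  by_contra h'
  obtain ⟨i, hi⟩ := leftSum_apply_ne_zero π h'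
  exact h ((π i).leftMatrix_apply_ne_zero hi).2.1

theorem rightSum_supported {π : ∀ i, G.Walk (z i) (x i)} (hπ : ∀ i, (π i).IsUnblockedPath)
    {a b : V} (h : ¬ G.dir a b) : rightSum π a b = 0 := by
  by_contra h'
  obtain ⟨i, hi⟩ := rightSum_apply_ne_zero π h'
  exact h ((π i).rightMatrix_apply_ne_zero (hπ i).2 hi).1

variable {π} [Fintype V]

/-- Thus `leftVec` is the error expansion of `z i` when the coefficients are `leftSum π`. The other
paths do not interfere: their left edges have heads on their own left sides, where this vector
vanishes. -/
theorem one_sub_leftSum_mulVec (hπ : ∀ i, (π i).IsUnblockedPath)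
    (hside : NoSidedIntersection π) (i : Fin k) :
    (1 - leftSum π) *ᵥ (π i).leftVec = Pi.single (z i) 1 := by
  have h : leftSum π *ᵥ (π i).leftVec = (π i).leftMatrix *ᵥ (π i).leftVec := by
    rw [leftSum, sum_mulVec]
    refine Finset.sum_eq_single i (fun j _ hji => ?_) (by simp)
    funext a
    refine Finset.sum_eq_zero fun b _ => ?_
    by_contra hb
    have hj := ((π j).leftMatrix_apply_ne_zero (left_ne_zero_of_mul hb)).2.2
    exact right_ne_zero_of_mul hb
      ((π i).leftVec_eq_zero (Set.disjoint_left.1 (hside j i hji).1 hj))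
  rw [sub_mulVec, one_mulVec, h, (π i).leftMatrix_mulVec (hπ i).1, sub_sub_cancel]

theorem one_sub_rightSum_mulVec (hπ : ∀ i, (π i).IsUnblockedPath)
    (hside : NoSidedIntersection π) (i : Fin k) :
    (1 - rightSum π) *ᵥ (π i).rightVec = Pi.single (x i) 1 := by
  have h : rightSum π *ᵥ (π i).rightVec = (π i).rightMatrix *ᵥ (π i).rightVec := by
    rw [rightSum, sum_mulVec]
    refine Finset.sum_eq_single i (fun j _ hji => ?_) (by simp)
    funext a
    refine Finset.sum_eq_zero fun b _ => ?_
    by_contra hb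
    have hj := ((π j).rightMatrix_apply_ne_zero (hπ j).2 (left_ne_zero_of_mul hb)).2
    exact right_ne_zero_of_mul hb
      ((π i).rightVec_eq_zero (Set.disjoint_left.1 (hside j i hji).2 hj))
  rw [sub_mulVec, one_mulVec, h, (π i).rightMatrix_mulVec (hπ i), sub_sub_cancel]

end

end MixedGraph

/-! ### Generic invertibility of the linear system, and identification -/

namespace MixedGraph

variable {V : Type*} [DecidableEq V] {G : MixedGraph V} {k : ℕ}

open Classical in
/-- The matrix with columns the coefficients of the variables `(z j)*`. -/
noncomputable def starMatrix {R : Type*} [CommRing R] (K : Set (V × V)) (z : Fin k → V)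
    (Λ : Matrix V V R) : Matrix V (Fin k) R :=
  of fun a j => (if a = z j then 1 else 0) - if (a, z j) ∈ K then Λ a (z j) else 0

/-- The matrix with columns the unit vectors at the nodes `x j`. -/
def unitMatrix (R : Type*) [CommRing R] (x : Fin k → V) : Matrix V (Fin k) R :=
  of fun a j => if a = x j then 1 else 0

theorem starMatrix_map {R S : Type*} [CommRing R] [CommRing S] (φ : R →+* S) (K : Set (V × V))
    (z : Fin k → V) (Λ : Matrix V V R) :
    (starMatrix K z Λ).map φ = starMatrix K z (Λ.map φ) := by
  ext a j
  by_cases h : a = z j <;> by_cases h' : (a, z j) ∈ K <;> simp [starMatrix, h']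

theorem unitMatrix_map {R S : Type*} [CommRing R] [CommRing S] (φ : R →+* S) (x : Fin k → V) :
    (unitMatrix R x).map φ = unitMatrix S x := by
  ext a j
  by_cases h : a = x j <;> simp [unitMatrix, h]

theorem starMatrix_col (K : Set (V × V)) (z : Fin k → V) (M : LinearSEM V) (j : Fin k) :
    (starMatrix K z M.Λ).col j = starVec M K (z j) := by
  funext a
  simp [starMatrix, starVec, LinearSEM.coefOn, Pi.single_apply]

theorem coefOn_edgesTo {x : Fin k → V} (hx : Function.Injective x) (y : V) (M : LinearSEM V) :
    M.coefOn (edgesTo x y) y = unitMatrix ℝ x *ᵥ fun i => M.Λ (x i) y := by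
  funext w
  simp only [LinearSEM.coefOn, edgesTo, Set.mem_range, Prod.mk.injEq, and_true, mulVec, dotProduct,
    unitMatrix, of_apply, ite_mul, one_mul, zero_mul]
  split_ifs with h
  · obtain ⟨i, rfl⟩ := h
    simp [hx.eq_iff]
  · exact (Finset.sum_eq_zero fun i _ => if_neg fun h' => h ⟨i, h'.symm⟩).symm

variable [Fintype V]

/-- The covariances of the variables `(z i)*` and `x j`, up to the factor `det (1 - Λ) ^ 2`. -/
noncomputable def starCov {R : Type*} [CommRing R] (K : Set (V × V)) (z x : Fin k → V)
    (Λ Ω : Matrix V V R) : Matrix (Fin k) (Fin k) R :=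
  (starMatrix K z Λ)ᵀ * ((adjugate (1 - Λ))ᵀ * Ω * adjugate (1 - Λ)) * unitMatrix R x

theorem map_one_sub {R S : Type*} [CommRing R] [CommRing S] (φ : R →+* S) (Λ : Matrix V V R) :
    (1 - Λ).map φ = 1 - Λ.map φ := by
  simpa using map_sub φ.mapMatrix 1 Λ

theorem adjugate_map {R S : Type*} [CommRing R] [CommRing S] (φ : R →+* S) (A : Matrix V V R) :
    (adjugate A).map φ = adjugate (A.map φ) := φ.map_adjugate A

theorem starCov_map {R S : Type*} [CommRing R] [CommRing S] (φ : R →+* S) (K : Set (V × V))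
    (z x : Fin k → V) (Λ Ω : Matrix V V R) :
    φ (starCov K z x Λ Ω).det = (starCov K z x (Λ.map φ) (Ω.map φ)).det := by
  rw [RingHom.map_det, starCov, starCov, RingHom.mapMatrix_apply]
  simp only [Matrix.map_mul, transpose_map, adjugate_map, map_one_sub, starMatrix_map,
    unitMatrix_map]

theorem det_map_mul_adjugate_mul {R S : Type*} [CommRing R] [CommRing S] (φ : R →+* S)
    (W : Matrix (Fin k) V R) (Λ : Matrix V V R) (T : Matrix V (Fin k) R) :
    φ (W * adjugate (1 - Λ) * T).det =
      (W.map φ * adjugate (1 - Λ.map φ) * T.map φ).det := by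
  rw [RingHom.map_det, RingHom.mapMatrix_apply]
  simp only [Matrix.map_mul, adjugate_map, map_one_sub]

theorem adjugate_eq_det_smul_inv {Λ : Matrix V V ℝ} (h : (1 - Λ).det ≠ 0) :
    adjugate (1 - Λ) = (1 - Λ).det • (1 - Λ)⁻¹ := by
  rw [Matrix.inv_def, Ring.inverse_eq_inv', smul_smul, mul_inv_cancel₀ h, one_smul]

/-- The columns of `r` are error expansions and `W` selects one error for each, so the product is
`(1 - Λ).det` times the identity. -/
theorem det_mul_adjugate_mul_ne_zero {Λ : Matrix V V ℝ} (h : (1 - Λ).det ≠ 0)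
    {W : Matrix (Fin k) V ℝ} {T r : Matrix V (Fin k) ℝ} (hr : (1 - Λ) * r = T)
    (hW : W * r = 1) : (W * adjugate (1 - Λ) * T).det ≠ 0 := by
  rw [← hr, Matrix.mul_assoc, ← Matrix.mul_assoc (adjugate _), adjugate_mul, smul_mul,
    Matrix.one_mul, Matrix.mul_smul, hW, det_smul, det_one, mul_one]
  exact pow_ne_zero _ h

open Polynomial in
/-- Two determinants that do not vanish at the two ends of a segment are both nonzero at some
point of it. -/
theorem exists_det_ne_zero (K : Set (V × V)) (z x : Fin k → V) (Λ₀ Λ₁ : Matrix V V ℝ)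
    (W₀ W₁ : Matrix (Fin k) V ℝ)
    (h₀ : (W₀ * adjugate (1 - Λ₀) * starMatrix K z Λ₀).det ≠ 0)
    (h₁ : (W₁ * adjugate (1 - Λ₁) * unitMatrix ℝ x).det ≠ 0) :
    ∃ t : ℝ, ((((1 - t) • W₀ + t • W₁) * adjugate (1 - ((1 - t) • Λ₀ + t • Λ₁)) *
        starMatrix K z ((1 - t) • Λ₀ + t • Λ₁)).det ≠ 0 ∧
      (((1 - t) • W₀ + t • W₁) * adjugate (1 - ((1 - t) • Λ₀ + t • Λ₁)) *
        unitMatrix ℝ x).det ≠ 0) := by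
  -- With the segment parameter as an indeterminate, both determinants are polynomials: one is
  -- nonzero at `0`, the other at `1`, so their product is a nonzero polynomial.
  set Λ : Matrix V V ℝ[X] := (1 - X : ℝ[X]) • Λ₀.map C + (X : ℝ[X]) • Λ₁.map C with hΛ
  set W : Matrix (Fin k) V ℝ[X] := (1 - X : ℝ[X]) • W₀.map C + (X : ℝ[X]) • W₁.map C with hW
  have hΛt : ∀ t : ℝ, Λ.map (evalRingHom t) = (1 - t) • Λ₀ + t • Λ₁ := fun t => by
    ext a b; simp [hΛ]; ring
  have hWt : ∀ t : ℝ, W.map (evalRingHom t) = (1 - t) • W₀ + t • W₁ := fun t => by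
    ext a b; simp [hW]; ring
  set p := (W * adjugate (1 - Λ) * starMatrix K z Λ).det with hp
  set q := (W * adjugate (1 - Λ) * unitMatrix ℝ[X] x).det with hq
  have hpt : ∀ t : ℝ, p.eval t = (((1 - t) • W₀ + t • W₁) *
      adjugate (1 - ((1 - t) • Λ₀ + t • Λ₁)) * starMatrix K z ((1 - t) • Λ₀ + t • Λ₁)).det := by
    intro t
    rw [← coe_evalRingHom, hp, det_map_mul_adjugate_mul, starMatrix_map, hΛt, hWt]
  have hqt : ∀ t : ℝ, q.eval t = (((1 - t) • W₀ + t • W₁) *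
      adjugate (1 - ((1 - t) • Λ₀ + t • Λ₁)) * unitMatrix ℝ x).det := by
    intro t
    rw [← coe_evalRingHom, hq, det_map_mul_adjugate_mul, unitMatrix_map, hΛt, hWt]
  have hp0 : p ≠ 0 := fun h => h₀ (by simpa [h] using (hpt 0).symm)
  have hq0 : q ≠ 0 := fun h => h₁ (by simpa [h] using (hqt 1).symm)
  obtain ⟨t, ht⟩ : ∃ t, (p * q).eval t ≠ 0 := by
    by_contra! h
    exact mul_ne_zero hp0 hq0 (Polynomial.funext fun t => by rw [h t, eval_zero])
  rw [eval_mul, hpt, hqt] at ht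
  exact ⟨t, left_ne_zero_of_mul ht, right_ne_zero_of_mul ht⟩

theorem exists_pos_det_ne_zero (K : Set (V × V)) (z x : Fin k → V) (Λ Ω : Matrix V V ℝ)
    (h : (starCov K z x Λ Ω).det ≠ 0) : ∃ ε : ℝ, 0 < ε ∧
      (starCov K z x Λ (Ω + ε • 1)).det ≠ 0 := by
  have hc : Continuous fun ε : ℝ => (starCov K z x Λ (Ω + ε • 1)).det := by
    unfold starCov
    fun_prop
  have h0 : ∀ᶠ ε in nhds (0 : ℝ), (starCov K z x Λ (Ω + ε • 1)).det ≠ 0 :=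
    hc.continuousAt.eventually_ne (by simpa using h)
  obtain ⟨ε, hε, hpos⟩ := ((h0.filter_mono nhdsWithin_le_nhds).and
    (self_mem_nhdsWithin (s := Set.Ioi (0 : ℝ)))).exists
  exact ⟨ε, hpos, hε⟩

variable {x z : Fin k → V} {K : Set (V × V)}

/-- The left side of one path may meet the right side of another, so the two choices of coefficients
cannot simply be combined; hence the generic point of the line through them. -/
theorem exists_model_det_ne_zero (hG : G.Acyclic) {π : ∀ i, G.Walk (z i) (x i)}
    (hπ : ∀ i, (π i).IsUnblockedPath) (hside : NoSidedIntersection π)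
    (hK : ∀ i, Disjoint (π i).dirEdges (edgesInto K (z i))) :
    ∃ M ∈ G.models, (starCov K z x M.Λ M.Ω).det ≠ 0 := by
  set W₀ : Matrix (Fin k) V ℝ := (unitMatrix ℝ fun i => (π i).leftTop)ᵀ with hW₀
  set W₁ : Matrix (Fin k) V ℝ := (unitMatrix ℝ fun i => (π i).rightTop)ᵀ with hW₁
  -- At `leftSum π` the auxiliary variables coincide with the `z j`: a known edge into `z j` is not
  -- on `π j` by `hK`, and not a left edge of another path, since its head `z j` is in `(π j).left`.
  have hstar : starMatrix K z (leftSum π) = unitMatrix ℝ z := by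
    ext a j
    have : (a, z j) ∈ K → leftSum π a (z j) = 0 := by
      intro haK
      by_contra h
      obtain ⟨i, hi⟩ := leftSum_apply_ne_zero π h
      obtain ⟨he, -, hl⟩ := (π i).leftMatrix_apply_ne_zero hi
      by_cases hij : i = j
      · subst hij
        exact Set.disjoint_left.1 (hK i) he ⟨haK, rfl⟩
      · exact Set.disjoint_left.1 (hside i j hij).1 hl (Set.mem_insert _ _)
    by_cases haK : (a, z j) ∈ K <;> simp [starMatrix, unitMatrix, haK, this]
  have h₀ : (W₀ * adjugate (1 - leftSum π) * starMatrix K z (leftSum π)).det ≠ 0 := by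
    refine det_mul_adjugate_mul_ne_zero (hG.det_ne_zero fun a b => leftSum_supported π)
      (r := of fun a j => (π j).leftVec a) ?_ ?_
    · rw [hstar]
      ext a j
      have := congrFun (one_sub_leftSum_mulVec hπ hside j) a
      exact this.trans (by simp [unitMatrix, Pi.single_apply])
    · ext i j
      simp [hW₀, unitMatrix, mul_apply, one_apply, leftVec_leftTop_eq hπ hside]
  have h₁ : (W₁ * adjugate (1 - rightSum π) * unitMatrix ℝ x).det ≠ 0 := by
    refine det_mul_adjugate_mul_ne_zero (hG.det_ne_zero fun a b => rightSum_supported hπ)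
      (r := of fun a j => (π j).rightVec a) ?_ ?_
    · ext a j
      have := congrFun (one_sub_rightSum_mulVec hπ hside j) a
      exact this.trans (by simp [unitMatrix, Pi.single_apply])
    · ext i j
      simp [hW₁, unitMatrix, mul_apply, one_apply, rightVec_rightTop_eq hπ hside]
  obtain ⟨t, htz, htx⟩ := exists_det_ne_zero K z x _ _ W₀ W₁ h₀ h₁
  set W := (1 - t) • W₀ + t • W₁ with hW
  set Λ := (1 - t) • leftSum π + t • rightSum π with hΛ
  -- The covariances factor through the `k` rows of `W`, so the determinant is a product of two and
  -- no cancellation between different path systems can occur.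
  have hprod : (starCov K z x Λ (Wᵀ * W)).det ≠ 0 := by
    have : starCov K z x Λ (Wᵀ * W) = (W * adjugate (1 - Λ) * starMatrix K z Λ)ᵀ *
        (W * adjugate (1 - Λ) * unitMatrix ℝ x) := by
      simp only [starCov, transpose_mul, Matrix.mul_assoc]
    rw [this, det_mul, det_transpose]
    exact mul_ne_zero htz htx
  obtain ⟨ε, hε, hdet⟩ := exists_pos_det_ne_zero K z x Λ (Wᵀ * W) hprod
  refine ⟨⟨Λ, Wᵀ * W + ε • 1⟩, ⟨fun a b hab => ?_, ?_, fun a b hab hbid => ?_⟩, hdet⟩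
  · simp [hΛ, leftSum_supported π hab, rightSum_supported hπ hab]
  · refine PosDef.posSemidef_add ?_ (PosDef.one.smul hε)
    simpa using posSemidef_conjTranspose_mul_self W
  · change (Wᵀ * W + ε • (1 : Matrix V V ℝ)) a b = 0
    rw [Matrix.add_apply, Matrix.smul_apply, one_apply_ne hab, smul_zero, add_zero, mul_apply]
    refine Finset.sum_eq_zero fun i _ => ?_
    rw [transpose_apply]
    -- Row `i` of `W` lives on the two tops of `π i`, which are equal or joined by a bidirected
    -- edge; so `Wᵀ * W` respects the graph.
    have hWi : ∀ c, W i c ≠ 0 → c = (π i).leftTop ∨ c = (π i).rightTop := by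
      intro c hc
      by_contra! h
      simp [hW, hW₀, hW₁, unitMatrix, h.1, h.2] at hc
    by_contra h
    have ha := hWi a (left_ne_zero_of_mul h)
    have hb := hWi b (right_ne_zero_of_mul h)
    have ht := (π i).tops_eq_or_bid
    rcases ht with ht | ht
    · rw [ht] at ha hb
      exact hab ((ha.elim id id).trans (hb.elim id id).symm)
    · rcases ha with rfl | rfl <;> rcases hb with rfl | rfl
      · exact hab rfl
      · exact hbid ht
      · exact hbid (G.bid_symm _ _ ht)
      · exact hab rfl

theorem starCov_eq (hG : G.Acyclic) {M : LinearSEM V} (hM : M ∈ G.models) :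
    starCov K z x M.Λ M.Ω =
      (1 - M.Λ).det ^ 2 • ((starMatrix K z M.Λ)ᵀ * M.covMatrix * unitMatrix ℝ x) := by
  rw [starCov, adjugate_eq_det_smul_inv (hG.det_ne_zero hM.1), LinearSEM.covMatrix]
  simp only [transpose_smul, smul_mul, Matrix.mul_smul, smul_smul, sq]

/-- This is the linear system for the unknown coefficients; row `i` says that the auxiliary variable
of `z i` is uncorrelated with `y - ∑ λ j * x j`. -/
theorem starMatrix_covMatrix_mulVec (hG : G.Acyclic) (hx : Function.Injective x) {y : V}
    (hsep : ∀ i, (G.deleteEdges (edgesTo x y ∪ edgesInto K (z i))).DSeparated (z i) y)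
    {M : LinearSEM V} (hM : M ∈ G.models) :
    ((starMatrix K z M.Λ)ᵀ * M.covMatrix * unitMatrix ℝ x) *ᵥ (fun i => M.Λ (x i) y) =
      (starMatrix K z M.Λ)ᵀ *ᵥ M.covMatrix *ᵥ Pi.single y 1 := by
  rw [← mulVec_mulVec, ← mulVec_mulVec, ← coefOn_edgesTo hx]
  funext i
  have h := starVec_covMatrix_mulVec hG hM (by rintro _ ⟨j, rfl⟩; rfl) (hsep i)
  rw [mulVec_sub, dotProduct_sub, sub_eq_zero, ← starMatrix_col K z] at h
  exact h.symm

theorem identified (hG : G.Acyclic) (hx : Function.Injective x) {y : V}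
    (hsep : ∀ i, (G.deleteEdges (edgesTo x y ∪ edgesInto K (z i))).DSeparated (z i) y)
    {π : ∀ i, G.Walk (z i) (x i)} (hπ : ∀ i, (π i).IsUnblockedPath)
    (hside : NoSidedIntersection π)
    (hK : ∀ i, Disjoint (π i).dirEdges (edgesInto K (z i))) : G.Identified K (edgesTo x y) := by
  let P := MvPolynomial ((V × V) ⊕ (V × V)) ℝ
  let ΛX : Matrix V V P := of fun a b => MvPolynomial.X (.inl (a, b))
  let ΩX : Matrix V V P := of fun a b => MvPolynomial.X (.inr (a, b))
  have heval : ∀ M : LinearSEM V, MvPolynomial.eval M.entries (starCov K z x ΛX ΩX).det =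
      (starCov K z x M.Λ M.Ω).det := by
    intro M
    rw [starCov_map]
    congr 2 <;> ext a b <;> simp [ΛX, ΩX, LinearSEM.entries]
  refine ⟨(starCov K z x ΛX ΩX).det, ?_, ?_⟩
  · obtain ⟨M, hM, h⟩ := exists_model_det_ne_zero hG hπ hside hK
    exact ⟨M, hM, by rwa [heval]⟩
  · rintro M hM hne N hN hcov hNK _ ⟨i, rfl⟩
    rw [heval, starCov_eq hG hM, det_smul] at hne
    -- The auxiliary variables involve known coefficients only, so `M` and `N` solve the same
    -- invertible system.
    have hstar : starMatrix K z N.Λ = starMatrix K z M.Λ := by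
      ext a j
      by_cases h : (a, z j) ∈ K
      · simp [starMatrix, h, hNK _ h]
      · simp [starMatrix, h]
    have hMy := starMatrix_covMatrix_mulVec hG hx hsep hM
    have hNy := starMatrix_covMatrix_mulVec hG hx hsep hN
    rw [hstar, hcov, ← hMy] at hNy
    exact congrFun (mulVec_injective_of_isUnit ((isUnit_iff_isUnit_det _).2
      (isUnit_iff_ne_zero.2 (right_ne_zero_of_mul hne))) hNy) i

end MixedGraph

theorem theorem1 {V : Type*} [Fintype V] [DecidableEq V] (G : MixedGraph V) (hG : G.Acyclic)
    (EZ : Set (V × V)) (hEZ : ∀ e ∈ EZ, G.dir e.1 e.2)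
    {k : ℕ} (x : Fin k → V) (hx : Function.Injective x) (y : V) (hxy : ∀ i, G.dir (x i) y)
    (z : Fin k → V) (hz : Function.Injective z)
    (hsep : ∀ i, (G.deleteEdges
      (MixedGraph.edgesTo x y ∪ MixedGraph.edgesInto EZ (z i))).DSeparated (z i) y)
    (π : ∀ i, G.Walk (z i) (x i)) (hπ : ∀ i, (π i).IsUnblockedPath)
    (hside : MixedGraph.NoSidedIntersection π) :
    G.IsAuxInstrumentalSet EZ x y z ∧
    ((∀ i, Disjoint (π i).dirEdges (MixedGraph.edgesInto EZ (z i))) →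
      G.Identified EZ (MixedGraph.edgesTo x y)) :=
  ⟨MixedGraph.isAuxInstrumentalSet hG x y z hz hsep π hπ hside,
    MixedGraph.identified hG hx hsep hπ hside⟩
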